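/- Let $W=(W_t)_{t\ge 0}$ be a Wiener process on a probability space $(\Omega,\mathcal F,\mathbf P)$ and let $\mathcal F_t=\sigma(W_s,\ 0\le s\le t)$. Let $S_0\ge 0$ and $\sigma\ge 0$ be constants and let $$S_t=S_0\,e^{\sigma W_t-\sigma^2t/2},\qquad 0\le t\le 1,$$ be the asset price in the Black--Scholes model $dS_t=\sigma S_t\,dW_t$ with zero interest rate. Put $t_j=j/n$ for $0\le j\le n$. If $\beta=(\beta(t))_{0\le t\le 1}$ is a real-valued process that is adapted to $(\mathcal F_t)_{0\le t\le 1}$ and whose paths are almost surely continuous on $[0,1]$, then $$\frac1{\sqrt n}\sum_{j=1}^n\beta(t_{j-1})\,\bigl|S_{t_j}-S_{t_{j-1}}\bigr|\ \longrightarrow\ \sqrt{\frac2\pi}\;\sigma\int_0^1S_t\,\beta(t)\,dt\qquad\text{in probability as } n\to\infty.$$ -/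

import Mathlib

open MeasureTheory ProbabilityTheory Filter
open scoped NNReal

/-- The stock price `S_t = S₀ exp(σ W_t - σ² t / 2)` of the Black-Scholes model
`dS_t = σ S_t dW_t` with zero interest rate. -/
noncomputable def stockPrice {Ω : Type*} (S₀ σ : ℝ) (W : ℝ≥0 → Ω → ℝ) (t : ℝ≥0) (ω : Ω) : ℝ :=
  S₀ * Real.exp (σ * W t ω - σ ^ 2 * (t : ℝ) / 2)

/-- The `j`-th point `t_j = j / n` of the uniform grid on `[0, 1]`. -/
noncomputable def gridTime (n j : ℕ) : ℝ≥0 := (j : ℝ≥0) / (n : ℝ≥0)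

/-- The normalised weighted sum `n^{-1/2} ∑_{j=1}^n β(t_{j-1}) |S_{t_j} - S_{t_{j-1}}|`.
The summation index below is `j - 1`, running over `0, …, n - 1`. -/
noncomputable def weightedVariation {Ω : Type*} (S β : ℝ≥0 → Ω → ℝ) (n : ℕ) (ω : Ω) : ℝ :=
  1 / Real.sqrt (n : ℝ) * ∑ j ∈ Finset.range n,
    β (gridTime n j) ω * |S (gridTime n (j + 1)) ω - S (gridTime n j) ω|

open scoped Topology

/-! Put `Z_j = √n (W_{t_{j+1}} - W_{t_j})`, a standard normal variable independent of the past at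
`t_j`. Factoring `S_{t_j}` out of each increment turns the sum into `(1/n) ∑ S_{t_j} β(t_j)
g_n(Z_j)`, with `g_n` the function `scaledIncrement σ n`. As `g_n(z) → σ|z|` under a domination free
of `n`, the means `c_n = E g_n(Z)` tend to `σ E|Z| = σ √(2/π)`. Write `g_n = c_n + (g_n - c_n)`. The
`c_n` part is `c_n` times a Riemann sum of an almost surely continuous path. The rest is an average
of martingale differences with bounded variance, so its second moment is `O(1/n)` once the weights
`S β` are truncated (`tendstoInMeasure_weighted_average`). -/

open Finset in
/-- Left Riemann sums of a continuous function on `[0, 1]` converge to its integral. -/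
theorem tendsto_left_riemann_sum {f : ℝ → ℝ} (hf : ContinuousOn f (Set.Icc 0 1)) :
    Tendsto (fun n : ℕ => 1 / (n : ℝ) * ∑ j ∈ range n, f ((j : ℝ) / n)) atTop
      (𝓝 (∫ t in (0 : ℝ)..1, f t)) := by
  have huc := isCompact_Icc.uniformContinuousOn_of_continuous hf
  rw [Metric.uniformContinuousOn_iff] at huc
  rw [Metric.tendsto_atTop]
  intro ε hε
  obtain ⟨δ, hδ, h⟩ := huc (ε / 2) (by positivity)
  obtain ⟨N, hN⟩ := exists_nat_gt (1 / δ)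
  refine ⟨N + 1, fun n hn => ?_⟩
  have hn0 : (0 : ℝ) < n := by exact_mod_cast (by omega : 0 < n)
  have hnδ : 1 / (n : ℝ) < δ := by
    rw [div_lt_comm₀ hn0 hδ]
    exact hN.trans_le (by exact_mod_cast (by omega : N ≤ n))
  have hmem : ∀ j < n, Set.Icc ((j : ℝ) / n) (((j + 1 : ℕ) : ℝ) / n) ⊆ Set.Icc 0 1 := by
    intro j hj x hx
    refine ⟨le_trans (by positivity) hx.1, hx.2.trans ?_⟩
    rw [div_le_one hn0]
    exact_mod_cast hj
  have hle : ∀ j : ℕ, (j : ℝ) / n ≤ ((j + 1 : ℕ) : ℝ) / n := fun j => by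
    gcongr; simp
  have hint : ∀ j < n, IntervalIntegrable f volume ((j : ℝ) / n) (((j + 1 : ℕ) : ℝ) / n) := by
    intro j hj
    apply ContinuousOn.intervalIntegrable
    rw [Set.uIcc_of_le (hle j)]
    exact hf.mono (hmem j hj)
  have hsum := intervalIntegral.sum_integral_adjacent_intervals
    (a := fun j : ℕ => (j : ℝ) / n) (n := n) (f := f) (μ := volume) hint
  simp only [Nat.cast_zero, zero_div, div_self hn0.ne'] at hsum
  rw [dist_comm, dist_eq_norm, ← hsum, mul_sum, ← sum_sub_distrib]
  refine lt_of_le_of_lt (norm_sum_le _ _) ?_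
  have hb : ∀ j ∈ range n, ‖(∫ x in ((j : ℝ) / n)..(((j + 1 : ℕ) : ℝ) / n), f x)
      - 1 / n * f ((j : ℝ) / n)‖ ≤ ε / 2 * (1 / n) := by
    intro j hj
    have hj := mem_range.1 hj
    have hlen : ((j + 1 : ℕ) : ℝ) / n - (j : ℝ) / n = 1 / n := by push_cast; ring
    have : 1 / n * f ((j : ℝ) / n)
        = ∫ x in ((j : ℝ) / n)..(((j + 1 : ℕ) : ℝ) / n), f ((j : ℝ) / n) := by
      rw [intervalIntegral.integral_const, hlen, smul_eq_mul]
    rw [this, ← intervalIntegral.integral_sub (hint j hj) (by simp)]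
    refine (intervalIntegral.norm_integral_le_of_norm_le_const fun x hx => ?_).trans_eq
      (b := ε / 2 * |((j + 1 : ℕ) : ℝ) / n - (j : ℝ) / n|) ?_
    · rw [Set.uIoc_of_le (hle j)] at hx
      rw [← dist_eq_norm]
      refine (h x (hmem j hj ⟨hx.1.le, hx.2⟩) _ (hmem j hj ⟨le_rfl, hle j⟩) ?_).le
      rw [Real.dist_eq, abs_of_nonneg (by linarith [hx.1])]
      linarith [hx.2]
    · rw [hlen, abs_of_nonneg (by positivity)]
  refine (sum_le_sum hb).trans_lt ?_
  rw [sum_const, card_range, nsmul_eq_mul]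
  field_simp
  linarith

/-! ### One-step increments under the standard normal law -/

/-- The first absolute moment of the standard normal distribution. -/
theorem integral_abs_gaussianReal : ∫ x, |x| ∂(gaussianReal 0 1) = Real.sqrt (2 / Real.pi) := by
  rw [integral_gaussianReal_eq_integral_smul one_ne_zero]
  have h1 : ∀ x : ℝ, gaussianPDFReal 0 1 x • |x|
      = (Real.sqrt (2 * Real.pi))⁻¹ * (|x| * Real.exp (-(1 / 2) * |x| ^ 2)) := by
    intro x
    simp only [gaussianPDFReal, smul_eq_mul, sq_abs, NNReal.coe_one, sub_zero, mul_one]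
    ring_nf
  simp_rw [h1]
  rw [integral_const_mul, integral_comp_abs (f := fun x : ℝ => x * Real.exp (-(1 / 2) * x ^ 2))]
  have h2 : ∫ x in Set.Ioi (0 : ℝ), x * Real.exp (-(1 / 2) * x ^ 2) = 1 := by
    have := integral_rpow_mul_exp_neg_mul_rpow (p := 2) (q := 1) (b := 1 / 2)
      (by norm_num) (by norm_num) (by norm_num)
    norm_num at this
    simpa using this
  rw [h2, mul_one, Real.sqrt_div zero_le_two, Real.sqrt_mul zero_le_two]
  have := Real.sqrt_pos.2 Real.pi_pos
  have h3 : Real.sqrt 2 * Real.sqrt 2 = 2 := Real.mul_self_sqrt zero_le_two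
  field_simp
  linarith

/-- The rescaled absolute relative increment over a time step `1 / n` of the exponential martingale
with volatility `σ`, as a function of the normalised increment `z` of the driving Wiener process. -/
noncomputable def scaledIncrement (σ : ℝ) (n : ℕ) (z : ℝ) : ℝ :=
  Real.sqrt n * |Real.exp (σ * (z / Real.sqrt n) - σ ^ 2 * (1 / n) / 2) - 1|

@[fun_prop]
theorem measurable_scaledIncrement (σ : ℝ) (n : ℕ) : Measurable (scaledIncrement σ n) := by
  unfold scaledIncrement
  fun_prop

theorem scaledIncrement_nonneg (σ : ℝ) (n : ℕ) (z : ℝ) : 0 ≤ scaledIncrement σ n z := by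
  unfold scaledIncrement; positivity

/-- The exponent is at most `D / √n`, which absorbs the factor `√n`. A bound free of `n` serves both
dominated convergence and the uniform variance bound. -/
theorem scaledIncrement_le {σ : ℝ} (hσ : 0 ≤ σ) (n : ℕ) (z : ℝ) :
    scaledIncrement σ n z ≤ Real.exp (2 * (σ * |z| + σ ^ 2 / 2)) := by
  rcases Nat.eq_zero_or_pos n with rfl | hn
  · simp [scaledIncrement, Real.exp_nonneg]
  have h1n : (1 : ℝ) ≤ n := by exact_mod_cast hn
  have hs : 1 ≤ Real.sqrt n := Real.one_le_sqrt.2 h1n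
  set s := Real.sqrt n with hs_def
  have hss : (n : ℝ) = s ^ 2 := (Real.sq_sqrt (by positivity)).symm
  set D := σ * |z| + σ ^ 2 / 2 with hD
  have hD0 : 0 ≤ D := by positivity
  have hu : |σ * (z / s) - σ ^ 2 * (1 / n) / 2| ≤ D / s := by
    refine (abs_sub _ _).trans ?_
    rw [abs_mul, abs_div, abs_of_nonneg hσ, abs_of_pos (zero_lt_one.trans_le hs),
      abs_of_nonneg (by positivity : 0 ≤ σ ^ 2 * (1 / (n : ℝ)) / 2), hD, hss, add_div,
      ← mul_div_assoc]
    refine add_le_add_right ?_ _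
    rw [mul_one_div, div_right_comm (σ ^ 2) 2 s]
    gcongr
    nlinarith
  set u := σ * (z / s) - σ ^ 2 * (1 / n) / 2
  -- Follows from `1 + x ≤ exp x`, at `-u` when `0 ≤ u` and at `u` when `u ≤ 0`.
  have h2 : |Real.exp u - 1| ≤ |u| * Real.exp |u| := by
    rcases le_total 0 u with h | h
    · rw [abs_of_nonneg h, abs_of_nonneg (by linarith [Real.add_one_le_exp u])]
      have h4 : Real.exp u * Real.exp (-u) = 1 := by rw [← Real.exp_add]; simp
      nlinarith [Real.add_one_le_exp (-u), Real.exp_pos u]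
    · have h5 := Real.exp_le_one_iff.2 h
      rw [abs_of_nonpos h, abs_of_nonpos (by linarith)]
      nlinarith [Real.add_one_le_exp u, Real.one_le_exp (neg_nonneg.2 h)]
  calc s * |Real.exp u - 1| ≤ s * (|u| * Real.exp |u|) := by gcongr
    _ ≤ s * (D / s * Real.exp D) := by
        gcongr
        exact hu.trans (div_le_self hD0 hs)
    _ = D * Real.exp D := by field_simp
    _ ≤ Real.exp D * Real.exp D := by
        gcongr
        linarith [Real.add_one_le_exp D]
    _ = Real.exp (2 * D) := by rw [← Real.exp_add, two_mul]

theorem memLp_exp_abs_gaussianReal (σ : ℝ) :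
    MemLp (fun z : ℝ => Real.exp (2 * (σ * |z| + σ ^ 2 / 2))) 2 (gaussianReal 0 1) := by
  rw [memLp_two_iff_integrable_sq (by fun_prop)]
  have h := (integrable_exp_mul_abs (X := fun z : ℝ => z) (t := 4 * σ) (μ := gaussianReal 0 1)
    (integrable_exp_mul_gaussianReal _) (integrable_exp_mul_gaussianReal _)).const_mul
    (Real.exp (2 * σ ^ 2))
  refine h.congr (ae_of_all _ fun z => ?_)
  simp only
  rw [← Real.exp_add, ← Real.exp_nat_mul]
  congr 1
  push_cast
  ring

theorem memLp_scaledIncrement {σ : ℝ} (hσ : 0 ≤ σ) (n : ℕ) :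
    MemLp (scaledIncrement σ n) 2 (gaussianReal 0 1) :=
  (memLp_exp_abs_gaussianReal σ).of_le (by fun_prop) (ae_of_all _ fun z => by
    rw [Real.norm_of_nonneg (scaledIncrement_nonneg σ n z), Real.norm_of_nonneg (Real.exp_nonneg _)]
    exact scaledIncrement_le hσ n z)

theorem tendsto_scaledIncrement {σ : ℝ} (hσ : 0 ≤ σ) (z : ℝ) :
    Tendsto (fun n => scaledIncrement σ n z) atTop (𝓝 (σ * |z|)) := by
  -- With `h = 1 / √n`, so that `1 / n = h ^ 2`, `scaledIncrement` is the absolute difference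
  -- quotient of this curve at `0`.
  have hd : HasDerivAt (fun h : ℝ => Real.exp (σ * z * h - σ ^ 2 / 2 * h ^ 2)) (σ * z) 0 := by
    have h1 : HasDerivAt (fun h : ℝ => σ * z * h - σ ^ 2 / 2 * h ^ 2) (σ * z) 0 := by
      have := ((hasDerivAt_id' (0 : ℝ)).const_mul (σ * z)).fun_sub
        (((hasDerivAt_id' (0 : ℝ)).fun_pow 2).const_mul (σ ^ 2 / 2))
      simpa using this
    simpa using h1.exp
  have ht := hd.tendsto_slope_zero_right
  have hs : Tendsto (fun n : ℕ => (Real.sqrt n)⁻¹) atTop (𝓝[>] 0) :=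
    (tendsto_inv_atTop_nhdsGT_zero).comp (Real.tendsto_sqrt_atTop.comp tendsto_natCast_atTop_atTop)
  have h := (ht.comp hs).abs
  rw [abs_mul, abs_of_nonneg hσ] at h
  refine h.congr' ?_
  filter_upwards [eventually_gt_atTop 0] with n hn
  have hss : (n : ℝ) = Real.sqrt n ^ 2 := (Real.sq_sqrt (by positivity)).symm
  simp only [Function.comp, scaledIncrement, inv_inv, smul_eq_mul, zero_add, abs_mul,
    abs_of_nonneg (Real.sqrt_nonneg _)]
  rw [mul_zero, zero_pow two_ne_zero, mul_zero, sub_zero, Real.exp_zero, inv_pow, ← hss]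
  congr 4
  ring

theorem tendsto_integral_scaledIncrement {σ : ℝ} (hσ : 0 ≤ σ) :
    Tendsto (fun n => ∫ z, scaledIncrement σ n z ∂(gaussianReal 0 1)) atTop
      (𝓝 (Real.sqrt (2 / Real.pi) * σ)) := by
  rw [mul_comm, ← integral_abs_gaussianReal, ← integral_const_mul]
  refine tendsto_integral_of_dominated_convergence
    (fun z => Real.exp (2 * (σ * |z| + σ ^ 2 / 2))) (fun n => by fun_prop)
    ((memLp_exp_abs_gaussianReal σ).integrable (by norm_num)) (fun n => ae_of_all _ fun z => ?_)
    (ae_of_all _ fun z => tendsto_scaledIncrement hσ z)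
  rw [Real.norm_of_nonneg (scaledIncrement_nonneg σ n z)]
  exact scaledIncrement_le hσ n z

theorem variance_scaledIncrement_le {σ : ℝ} (hσ : 0 ≤ σ) (n : ℕ) :
    Var[scaledIncrement σ n; gaussianReal 0 1]
      ≤ ∫ z, Real.exp (2 * (σ * |z| + σ ^ 2 / 2)) ^ 2 ∂(gaussianReal 0 1) := by
  refine (variance_le_expectation_sq (by fun_prop)).trans ?_
  refine integral_mono (memLp_scaledIncrement hσ n).integrable_sq
    (memLp_exp_abs_gaussianReal σ).integrable_sq fun z => ?_
  simp only [Pi.pow_apply]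
  gcongr
  · exact scaledIncrement_nonneg σ n z
  · exact scaledIncrement_le hσ n z

/-! ### Weak law for martingale differences -/

/-- Orthogonality of martingale increments: a second moment bound for `∑ U_k Y_k`, where `U_k` is
bounded and known at time `k`, and `Y_k` is centred, independent of the past at time `k`, and known
at time `k + 1`. -/
theorem integral_sq_sum_mul_le {Ω : Type*} [m : MeasurableSpace Ω] {P : Measure Ω}
    [IsProbabilityMeasure P] {n : ℕ} {ℱ : ℕ → MeasurableSpace Ω} (hmono : Monotone ℱ)
    (hle : ∀ k, ℱ k ≤ m) {U Y : ℕ → Ω → ℝ} {N v : ℝ}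
    (hU : ∀ k < n, Measurable[ℱ k] (U k)) (hUN : ∀ k ω, |U k ω| ≤ N)
    (hY : ∀ k < n, Measurable[ℱ (k + 1)] (Y k)) (hY2 : ∀ k < n, MemLp (Y k) 2 P)
    (hind : ∀ k < n, Indep (MeasurableSpace.comap (Y k) inferInstance) (ℱ k) P)
    (hY0 : ∀ k < n, ∫ ω, Y k ω ∂P = 0) (hYv : ∀ k < n, ∫ ω, Y k ω ^ 2 ∂P ≤ v) :
    MemLp (fun ω => ∑ k ∈ Finset.range n, U k ω * Y k ω) 2 P ∧
      ∫ ω, (∑ k ∈ Finset.range n, U k ω * Y k ω) ^ 2 ∂P ≤ n * (N ^ 2 * v) := by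
  have hterm : ∀ k < n, MemLp (fun ω => U k ω * Y k ω) 2 P := fun k hk =>
    (hY2 k hk).of_le_mul (c := N)
      (((hU k hk).mono (hle k) le_rfl).aestronglyMeasurable.mul (hY2 k hk).aestronglyMeasurable)
      (ae_of_all _ fun ω => by
        rw [norm_mul]
        exact mul_le_mul_of_nonneg_right (hUN k ω) (norm_nonneg _))
  suffices H : ∀ l ≤ n, Measurable[ℱ l] (fun ω => ∑ k ∈ Finset.range l, U k ω * Y k ω) ∧
      MemLp (fun ω => ∑ k ∈ Finset.range l, U k ω * Y k ω) 2 P ∧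
      ∫ ω, (∑ k ∈ Finset.range l, U k ω * Y k ω) ^ 2 ∂P ≤ l * (N ^ 2 * v) from (H n le_rfl).2
  intro l
  induction l with
  | zero => intro _; simp
  | succ l ih =>
    intro hl
    have hl' : l < n := hl
    obtain ⟨ih1, ih2, ih3⟩ := ih hl'.le
    simp only [Finset.sum_range_succ]
    set M : Ω → ℝ := fun ω => ∑ k ∈ Finset.range l, U k ω * Y k ω with hM
    have hMU : MemLp (fun ω => M ω * U l ω) 2 P := ih2.of_le_mul (c := N)
      (ih2.aestronglyMeasurable.mul ((hU l hl').mono (hle l) le_rfl).aestronglyMeasurable)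
      (ae_of_all _ fun ω => by
        rw [norm_mul, mul_comm]
        exact mul_le_mul_of_nonneg_right (hUN l ω) (norm_nonneg _))
    have hMUm : Measurable[ℱ l] (fun ω => M ω * U l ω) := ih1.mul (hU l hl')
    have hindep : IndepFun (fun ω => M ω * U l ω) (Y l) P := by
      rw [IndepFun_iff_Indep]
      exact (indep_of_indep_of_le_right (hind l hl') hMUm.comap_le).symm
    -- `M * U l` is known at time `l`, hence independent of the centred `Y l`.
    have hcross : ∫ ω, (M ω * U l ω) * Y l ω ∂P = 0 := by
      rw [hindep.integral_fun_mul_eq_mul_integral hMU.aestronglyMeasurable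
        (hY2 l hl').aestronglyMeasurable, hY0 l hl', mul_zero]
    refine ⟨?_, ih2.add (hterm l hl'), ?_⟩
    · have hlt : ℱ l ≤ ℱ (l + 1) := hmono (Nat.le_succ l)
      exact (ih1.mono hlt le_rfl).add (((hU l hl').mono hlt le_rfl).mul (hY l hl'))
    · have hint2 : Integrable (fun ω => (M ω * U l ω) * Y l ω) P :=
        hMU.integrable_mul (hY2 l hl')
      have hsq : ∫ ω, (U l ω * Y l ω) ^ 2 ∂P ≤ N ^ 2 * v := by
        calc ∫ ω, (U l ω * Y l ω) ^ 2 ∂P ≤ ∫ ω, N ^ 2 * Y l ω ^ 2 ∂P := by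
              refine integral_mono (hterm l hl').integrable_sq
                ((hY2 l hl').integrable_sq.const_mul _) fun ω => ?_
              simp only [mul_pow]
              refine mul_le_mul_of_nonneg_right ?_ (sq_nonneg _)
              exact sq_le_sq' (abs_le.1 (hUN l ω)).1 (abs_le.1 (hUN l ω)).2
          _ = N ^ 2 * ∫ ω, Y l ω ^ 2 ∂P := integral_const_mul _ _
          _ ≤ N ^ 2 * v := by gcongr; exact hYv l hl'
      have hexp : ∀ ω, (M ω + U l ω * Y l ω) ^ 2
          = M ω ^ 2 + 2 * ((M ω * U l ω) * Y l ω) + (U l ω * Y l ω) ^ 2 := fun ω => by ring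
      rw [integral_congr_ae (ae_of_all _ hexp)]
      have hadd : Integrable (fun ω => M ω ^ 2 + 2 * ((M ω * U l ω) * Y l ω)) P :=
        ih2.integrable_sq.add (hint2.const_mul 2)
      rw [integral_add hadd (hterm l hl').integrable_sq,
        integral_add ih2.integrable_sq (hint2.const_mul 2), integral_const_mul, hcross]
      push_cast
      linarith

/-- A weak law of large numbers for martingale differences with bounded second moment and
predictable weights that are stochastically bounded. -/
theorem tendstoInMeasure_weighted_average {Ω : Type*} [m : MeasurableSpace Ω] {P : Measure Ω}
    [IsProbabilityMeasure P] {ℱ : ℕ → ℕ → MeasurableSpace Ω} (hmono : ∀ n, Monotone (ℱ n))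
    (hle : ∀ n k, ℱ n k ≤ m) {U Y : ℕ → ℕ → Ω → ℝ} {v : ℝ}
    (hU : ∀ n, ∀ k < n, Measurable[ℱ n k] (U n k))
    (hUb : ∀ᵐ ω ∂P, ∃ N : ℕ, ∀ n, ∀ k < n, |U n k ω| ≤ N)
    (hY : ∀ n, ∀ k < n, Measurable[ℱ n (k + 1)] (Y n k)) (hY2 : ∀ n, ∀ k < n, MemLp (Y n k) 2 P)
    (hind : ∀ n, ∀ k < n, Indep (MeasurableSpace.comap (Y n k) inferInstance) (ℱ n k) P)
    (hY0 : ∀ n, ∀ k < n, ∫ ω, Y n k ω ∂P = 0) (hYv : ∀ n, ∀ k < n, ∫ ω, Y n k ω ^ 2 ∂P ≤ v) :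
    TendstoInMeasure P (fun (n : ℕ) ω => 1 / (n : ℝ) * ∑ k ∈ Finset.range n, U n k ω * Y n k ω) atTop
      (fun _ => 0) := by
  rw [tendstoInMeasure_iff_norm]
  intro ε hε
  set B : ℕ → Set Ω := fun N => {ω | ¬ ∀ n, ∀ k < n, |U n k ω| ≤ N} with hB
  -- Only countably many conditions, each on a measurable function.
  have hBm : ∀ N, MeasurableSet (B N) := by
    intro N
    refine MeasurableSet.compl ?_
    refine measurableSet_setOfPred.2 <| Measurable.forall fun n => Measurable.forall fun k =>
      Measurable.forall fun hk => measurableSet_setOfPred.1 ?_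
    have := (hU n k hk).mono (hle n k) le_rfl
    exact measurableSet_le (by fun_prop) measurable_const
  have hBanti : Antitone B := by
    intro N N' hN ω hω h
    exact hω fun n k hk => (h n k hk).trans (by exact_mod_cast hN)
  have hB0 : Tendsto (fun N => P (B N)) atTop (𝓝 0) := by
    have h0 : P (⋂ N, B N) = 0 := by
      rw [measure_eq_zero_iff_ae_notMem]
      filter_upwards [hUb] with ω ⟨N, hN⟩ hω
      exact Set.mem_iInter.1 hω N hN
    rw [← h0]
    exact tendsto_measure_iInter_atTop (fun N => (hBm N).nullMeasurableSet) hBanti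
      ⟨0, measure_ne_top _ _⟩
  rw [ENNReal.tendsto_atTop_zero]
  intro δ hδ
  obtain ⟨N, hN⟩ := (ENNReal.tendsto_atTop_zero.1 hB0) (δ / 2) (ENNReal.half_pos hδ.ne')
  have hN := hN N le_rfl
  have hlim : Tendsto (fun n : ℕ => ENNReal.ofReal ((N : ℝ) ^ 2 * v / ε ^ 2 / n)) atTop (𝓝 0) := by
    have := ENNReal.tendsto_ofReal (tendsto_const_div_atTop_nhds_zero_nat ((N : ℝ) ^ 2 * v / ε ^ 2))
    simpa using this
  obtain ⟨n₀, hn₀⟩ := (ENNReal.tendsto_atTop_zero.1 hlim) (δ / 2) (ENNReal.half_pos hδ.ne')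
  refine ⟨n₀ + 1, fun n hn => ?_⟩
  have hn0 : (0 : ℝ) < n := by exact_mod_cast (by omega : 0 < n)
  -- Clipping to `[-N, N]` keeps the weights adapted and makes them bounded; it changes nothing off
  -- `B N`, a set of small probability. No moments of the weights are needed.
  set V : ℕ → Ω → ℝ := fun k ω => max (-(N : ℝ)) (min N (U n k ω)) with hV
  have hVN : ∀ k ω, |V k ω| ≤ N := by
    intro k ω
    rw [abs_le]
    exact ⟨le_max_left _ _, max_le (by linarith [(Nat.cast_nonneg N : (0 : ℝ) ≤ N)])
      (min_le_left _ _)⟩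
  obtain ⟨hX, hXv⟩ := integral_sq_sum_mul_le (P := P) (hmono n) (hle n) (U := V) (Y := Y n)
    (fun k hk => measurable_const.max (measurable_const.min (hU n k hk))) hVN (hY n) (hY2 n)
    (hind n) (hY0 n) (hYv n)
  set X : Ω → ℝ := fun ω => ∑ k ∈ Finset.range n, V k ω * Y n k ω with hXdef
  -- Chebyshev: the second moment is at most `n N² v`, against the threshold `(ε n)²`.
  have hcheb : P {ω | (ε * n) ^ 2 ≤ X ω ^ 2} ≤ ENNReal.ofReal ((N : ℝ) ^ 2 * v / ε ^ 2 / n) := by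
    have h1 := mul_meas_ge_le_integral_of_nonneg (μ := P) (f := fun ω => X ω ^ 2)
      (ae_of_all _ fun ω => sq_nonneg _) hX.integrable_sq ((ε * n) ^ 2)
    rw [← ENNReal.ofReal_toReal (measure_ne_top P _)]
    refine ENNReal.ofReal_le_ofReal ?_
    change P.real _ ≤ _
    have h2 := h1.trans hXv
    have h3 : (N : ℝ) ^ 2 * v / ε ^ 2 / n = n * (N ^ 2 * v) / (ε * n) ^ 2 := by
      field_simp
    rw [h3, le_div_iff₀' (by positivity)]
    exact h2
  have hsub : {ω | ε ≤ ‖1 / (n : ℝ) * ∑ k ∈ Finset.range n, U n k ω * Y n k ω - 0‖}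
      ⊆ {ω | (ε * n) ^ 2 ≤ X ω ^ 2} ∪ B N := by
    intro ω hω
    by_cases hb : ω ∈ B N
    · exact Or.inr hb
    · left
      simp only [hB, Set.mem_ofPred_eq, not_not] at hb
      have hXU : ∑ k ∈ Finset.range n, U n k ω * Y n k ω = X ω := by
        refine Finset.sum_congr rfl fun k hk => ?_
        have := abs_le.1 (hb n k (Finset.mem_range.1 hk))
        simp only [hV]
        rw [min_eq_right this.2, max_eq_right this.1]
      simp only [Set.mem_ofPred_eq] at hω ⊢
      rw [hXU, sub_zero, norm_mul, Real.norm_of_nonneg (by positivity), Real.norm_eq_abs,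
        one_div, ← div_eq_inv_mul, le_div_iff₀ hn0] at hω
      rw [← sq_abs (X ω)]
      gcongr
  calc P _ ≤ P ({ω | (ε * n) ^ 2 ≤ X ω ^ 2} ∪ B N) := measure_mono hsub
    _ ≤ P {ω | (ε * n) ^ 2 ≤ X ω ^ 2} + P (B N) := measure_union_le _ _
    _ ≤ δ / 2 + δ / 2 := by gcongr; exact hcheb.trans (hn₀ n (by omega))
    _ = δ := ENNReal.add_halves δ

/-- Convergence in measure is additive. -/
theorem MeasureTheory.TendstoInMeasure.add_real {Ω : Type*} [MeasurableSpace Ω] {P : Measure Ω}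
    {f g : ℕ → Ω → ℝ} {f' g' : Ω → ℝ} (hf : TendstoInMeasure P f atTop f')
    (hg : TendstoInMeasure P g atTop g') :
    TendstoInMeasure P (fun n ω => f n ω + g n ω) atTop (fun ω => f' ω + g' ω) := by
  rw [tendstoInMeasure_iff_norm] at *
  intro ε hε
  have h := (hf (ε / 2) (by positivity)).add (hg (ε / 2) (by positivity))
  rw [add_zero] at h
  refine tendsto_of_tendsto_of_tendsto_of_le_of_le tendsto_const_nhds h (fun _ => zero_le)
    fun n => (measure_mono fun ω hω => ?_).trans (measure_union_le _ _)
  by_contra hc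
  simp only [Set.mem_union, Set.mem_ofPred_eq, not_or, not_le] at hc hω
  have := norm_add_le (f n ω - f' ω) (g n ω - g' ω)
  rw [show f n ω - f' ω + (g n ω - g' ω) = f n ω + g n ω - (f' ω + g' ω) by ring] at this
  linarith [hc.1, hc.2]

/-! ### Grid points and Brownian increments -/

theorem gridTime_succ (n j : ℕ) : gridTime n (j + 1) = gridTime n j + 1 / (n : ℝ≥0) := by
  simp [gridTime, add_div]

theorem gridTime_le_one {n j : ℕ} (h : j ≤ n) : gridTime n j ≤ 1 :=
  div_le_one_of_le₀ (by exact_mod_cast h) zero_le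

theorem gridTime_mono (n : ℕ) : Monotone (gridTime n) := fun i j h => by
  unfold gridTime
  gcongr

theorem toNNReal_natCast_div (n j : ℕ) : ((j : ℝ) / n).toNNReal = gridTime n j := by
  rw [gridTime, Real.toNNReal_div (by positivity), Real.toNNReal_natCast, Real.toNNReal_natCast]

section

variable {Ω : Type*} {W : ℝ≥0 → Ω → ℝ}

/-- The increment of `W` over the `j`-th cell of the grid, normalised to unit variance. -/
noncomputable def normalizedIncrement (W : ℝ≥0 → Ω → ℝ) (n j : ℕ) (ω : Ω) : ℝ :=
  Real.sqrt n * (W (gridTime n (j + 1)) ω - W (gridTime n j) ω)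

/-- The ratio of consecutive prices depends only on the increment of `W`, and `S ≥ 0` leaves the
absolute value. -/
theorem abs_stockPrice_sub {S₀ : ℝ} (hS₀ : 0 ≤ S₀) (σ : ℝ) {n : ℕ} (hn : 0 < n) (j : ℕ) (ω : Ω) :
    1 / Real.sqrt n *
        |stockPrice S₀ σ W (gridTime n (j + 1)) ω - stockPrice S₀ σ W (gridTime n j) ω|
      = 1 / n * (stockPrice S₀ σ W (gridTime n j) ω
        * scaledIncrement σ n (normalizedIncrement W n j ω)) := by
  have hs : 0 < Real.sqrt n := Real.sqrt_pos.2 (by positivity)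
  have hss : (n : ℝ) = Real.sqrt n * Real.sqrt n := (Real.mul_self_sqrt (by positivity)).symm
  have hS : 0 ≤ stockPrice S₀ σ W (gridTime n j) ω := mul_nonneg hS₀ (Real.exp_nonneg _)
  set x := σ * (normalizedIncrement W n j ω / Real.sqrt n) - σ ^ 2 * (1 / n) / 2 with hx
  have hfac : stockPrice S₀ σ W (gridTime n (j + 1)) ω - stockPrice S₀ σ W (gridTime n j) ω
      = stockPrice S₀ σ W (gridTime n j) ω * (Real.exp x - 1) := by
    rw [mul_sub, mul_one]
    congr 1
    rw [stockPrice, stockPrice, mul_assoc, ← Real.exp_add]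
    congr 2
    rw [hx, normalizedIncrement, mul_div_cancel_left₀ _ hs.ne', gridTime_succ]
    push_cast
    ring
  rw [hfac, abs_mul, abs_of_nonneg hS, scaledIncrement, ← hx]
  rw [show 1 / (n : ℝ) = 1 / (Real.sqrt n * Real.sqrt n) by rw [← hss]]
  field_simp

theorem weightedVariation_stockPrice {S₀ : ℝ} (hS₀ : 0 ≤ S₀) (σ : ℝ) (β : ℝ≥0 → Ω → ℝ) (c : ℝ)
    (n : ℕ) (ω : Ω) :
    weightedVariation (stockPrice S₀ σ W) β n ω
      = 1 / (n : ℝ) * ∑ j ∈ Finset.range n,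
          stockPrice S₀ σ W (gridTime n j) ω * β (gridTime n j) ω
            * (scaledIncrement σ n (normalizedIncrement W n j ω) - c)
        + c * (1 / (n : ℝ) * ∑ j ∈ Finset.range n,
          stockPrice S₀ σ W (gridTime n j) ω * β (gridTime n j) ω) := by
  rw [weightedVariation, Finset.mul_sum, Finset.mul_sum, Finset.mul_sum, Finset.mul_sum,
    ← Finset.sum_add_distrib]
  refine Finset.sum_congr rfl fun j hj => ?_
  have hn : 0 < n := (Nat.zero_le j).trans_lt (Finset.mem_range.1 hj)
  rw [mul_left_comm, abs_stockPrice_sub hS₀ σ hn]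
  ring

theorem continuousOn_stockPrice_mul {S₀ σ : ℝ} {β : ℝ≥0 → Ω → ℝ} {ω : Ω}
    (hW : Continuous fun t => W t ω) (hβ : ContinuousOn (fun t => β t ω) (Set.Icc 0 1)) :
    ContinuousOn (fun t => stockPrice S₀ σ W t ω * β t ω) (Set.Icc 0 1) := by
  refine ContinuousOn.mul (Continuous.continuousOn ?_) hβ
  unfold stockPrice
  fun_prop

variable [MeasurableSpace Ω] {P : Measure Ω}

theorem hasLaw_normalizedIncrement (hW : IsPreBrownianReal W P) {n : ℕ} (hn : 0 < n) (j : ℕ) :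
    HasLaw (normalizedIncrement W n j) (gaussianReal 0 1) P := by
  have h := gaussianReal_const_mul (((hW.shift (gridTime n j)).hasLaw_eval (1 / (n : ℝ≥0))))
    (Real.sqrt n)
  rw [mul_zero] at h
  convert! h using 2
  · simp [normalizedIncrement, gridTime_succ]
  · have : (n : ℝ) ≠ 0 := by positivity
    ext
    simp [this]

/-- Markov property: the process restarted at `t_j` is independent of the past, and the increment is
a multiple of its value at time `1 / n`. -/
theorem indep_normalizedIncrement (hW : IsPreBrownianReal W P)
    (hWmeas : ∀ t, StronglyMeasurable (W t)) (n j : ℕ) :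
    Indep (MeasurableSpace.comap (normalizedIncrement W n j) inferInstance)
      (Filtration.natural W hWmeas (gridTime n j)) P := by
  rw [Filtration.natural_eq_comap]
  have h := (hW.indepFun_shift (gridTime n j)).comp
    (φ := fun x : ℝ≥0 → ℝ => Real.sqrt n * x (1 / (n : ℝ≥0))) (ψ := id) (by fun_prop) measurable_id
  rw [IndepFun_iff_Indep] at h
  convert! h using 2
  ext ω
  simp [normalizedIncrement, gridTime_succ]

theorem measurable_natural (hWmeas : ∀ t, StronglyMeasurable (W t)) {s t : ℝ≥0} (h : s ≤ t) :
    Measurable[Filtration.natural W hWmeas t] (W s) :=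
  Measurable.of_comap_le (le_iSup₂_of_le s h le_rfl)

theorem measurable_normalizedIncrement (hWmeas : ∀ t, StronglyMeasurable (W t)) (n j : ℕ) :
    Measurable[Filtration.natural W hWmeas (gridTime n (j + 1))] (normalizedIncrement W n j) :=
  ((measurable_natural hWmeas le_rfl).sub
    (measurable_natural hWmeas (gridTime_mono n j.le_succ))).const_mul _

theorem measurable_stockPrice (hWmeas : ∀ t, StronglyMeasurable (W t)) (S₀ σ : ℝ) (t : ℝ≥0) :
    Measurable[Filtration.natural W hWmeas t] (stockPrice S₀ σ W t) :=
  (Real.measurable_exp.comp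
    (((measurable_natural hWmeas le_rfl).const_mul σ).sub_const _)).const_mul S₀

end

/-! ### Convergence of the weighted sums -/

theorem mainTheorem6 {Ω : Type*} [MeasurableSpace Ω] (P : Measure Ω) [IsProbabilityMeasure P]
    (W : ℝ≥0 → Ω → ℝ) (hWmeas : ∀ t, StronglyMeasurable (W t)) (hW : IsBrownianReal W P)
    (S₀ σ : ℝ) (hS₀ : 0 ≤ S₀) (hσ : 0 ≤ σ)
    (β : ℝ≥0 → Ω → ℝ)
    (hβ_adapted : ∀ t : ℝ≥0, t ≤ 1 → Measurable[Filtration.natural W hWmeas t] (β t))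
    (hβ_cont : ∀ᵐ ω ∂P, ContinuousOn (fun t : ℝ≥0 => β t ω) (Set.Icc 0 1)) :
    TendstoInMeasure P
      (fun (n : ℕ) (ω : Ω) => weightedVariation (stockPrice S₀ σ W) β n ω)
      atTop
      (fun ω => Real.sqrt (2 / Real.pi) * σ *
        ∫ t in (0 : ℝ)..1, stockPrice S₀ σ W t.toNNReal ω * β t.toNNReal ω) := by
  -- Centring at the exact mean, not at its limit, makes the fluctuations true martingale
  -- differences for each `n`.
  set c : ℕ → ℝ := fun n => ∫ z, scaledIncrement σ n z ∂(gaussianReal 0 1) with hc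
  have hcont : ∀ᵐ ω ∂P, ContinuousOn (fun t => stockPrice S₀ σ W t ω * β t ω) (Set.Icc 0 1) := by
    filter_upwards [hW.cont, hβ_cont] with ω h1 h2 using continuousOn_stockPrice_mul h1 h2
  have hUm : ∀ n, ∀ k < n, Measurable[Filtration.natural W hWmeas (gridTime n k)]
      (fun ω => stockPrice S₀ σ W (gridTime n k) ω * β (gridTime n k) ω) := fun n k hk =>
    (measurable_stockPrice hWmeas S₀ σ _).mul (hβ_adapted _ (gridTime_le_one hk.le))
  have hlaw : ∀ n, ∀ k < n, HasLaw (normalizedIncrement W n k) (gaussianReal 0 1) P :=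
    fun n k hk => hasLaw_normalizedIncrement hW.toIsPreBrownianReal (k.zero_le.trans_lt hk) k
  have hL2 : ∀ n, MemLp (fun z => scaledIncrement σ n z - c n) 2 (gaussianReal 0 1) := fun n =>
    (memLp_scaledIncrement hσ n).sub (memLp_const _)
  have hR := tendstoInMeasure_weighted_average (P := P)
    (ℱ := fun n k => Filtration.natural W hWmeas (gridTime n k))
    (fun n i j hij => (Filtration.natural W hWmeas).mono (gridTime_mono n hij))
    (fun n k => (Filtration.natural W hWmeas).le _)
    (U := fun n k ω => stockPrice S₀ σ W (gridTime n k) ω * β (gridTime n k) ω)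
    (Y := fun n k ω => scaledIncrement σ n (normalizedIncrement W n k ω) - c n)
    (v := ∫ z, Real.exp (2 * (σ * |z| + σ ^ 2 / 2)) ^ 2 ∂(gaussianReal 0 1))
    hUm
    (by
      -- A continuous path on the compact `[0, 1]` is bounded, so one `N` serves all grids.
      filter_upwards [hcont] with ω h
      obtain ⟨C, hC⟩ := isCompact_Icc.exists_bound_of_continuousOn h
      obtain ⟨N, hN⟩ := exists_nat_ge C
      exact ⟨N, fun n k hk => (hC _ ⟨zero_le, gridTime_le_one hk.le⟩).trans hN⟩)
    (fun n k hk => ((measurable_scaledIncrement σ n).comp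
      (measurable_normalizedIncrement hWmeas n k)).sub_const _)
    (fun n k hk => ((hlaw n k hk).map_eq.symm ▸ hL2 n).comp_of_map (hlaw n k hk).aemeasurable)
    (fun n k hk => indep_of_indep_of_le_left
      (indep_normalizedIncrement hW.toIsPreBrownianReal hWmeas n k) (by
        have h : Measurable fun z => scaledIncrement σ n z - c n := by fun_prop
        exact (h.comp (comap_measurable (normalizedIncrement W n k))).comap_le))
    (fun n k hk => by
      have h := (hlaw n k hk).integral_comp (hL2 n).aestronglyMeasurable
      simp only [Function.comp_def] at h
      rw [h, integral_sub ((memLp_scaledIncrement hσ n).integrable (by norm_num))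
        (integrable_const _)]
      simp [hc])
    (fun n k hk => by
      have h := (hlaw n k hk).integral_comp (hL2 n).integrable_sq.aestronglyMeasurable
      simp only [Function.comp_def] at h
      rw [h, ← variance_eq_integral (by fun_prop)]
      exact variance_scaledIncrement_le hσ n)
  have hT : TendstoInMeasure P (fun (n : ℕ) ω => c n * (1 / (n : ℝ) * ∑ j ∈ Finset.range n,
      stockPrice S₀ σ W (gridTime n j) ω * β (gridTime n j) ω)) atTop
      (fun ω => Real.sqrt (2 / Real.pi) * σ *
        ∫ t in (0 : ℝ)..1, stockPrice S₀ σ W t.toNNReal ω * β t.toNNReal ω) := by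
    refine tendstoInMeasure_of_tendsto_ae (fun n => ?_) ?_
    · refine Measurable.aestronglyMeasurable (((Finset.measurable_fun_sum _ fun j hj => ?_).const_mul
        _).const_mul _)
      exact (hUm n j (Finset.mem_range.1 hj)).mono ((Filtration.natural W hWmeas).le _) le_rfl
    · filter_upwards [hcont] with ω h
      refine (tendsto_integral_scaledIncrement hσ).mul ?_
      have h' : ContinuousOn
          (fun t : ℝ => stockPrice S₀ σ W t.toNNReal ω * β t.toNNReal ω) (Set.Icc 0 1) :=
        h.comp continuous_real_toNNReal.continuousOn fun t ht =>
          ⟨zero_le, Real.toNNReal_le_one.2 ht.2⟩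
      simpa only [toNNReal_natCast_div] using tendsto_left_riemann_sum h'
  have h := hR.add_real hT
  simp only [zero_add] at h
  exact h.congr_left fun n => ae_of_all _ fun ω =>
    (weightedVariation_stockPrice hS₀ σ β (c n) n ω).symm
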